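/- Let $q\in\{2,3\}$ and let $\Omega\subset\mathbb R^q$ be a bounded open set. Write $(\cdot,\cdot)$, $\|\cdot\|$ for the $L^2(\Omega)$ inner product and norm (also used for the pairing $\int_\Omega g\cdot w$ whenever it exists), $b(u,v,w)=(u\cdot\nabla v,w)$, and $H_0^1$ for $[H_0^1(\Omega)]^q$. (i) $b(u,v,w)$ is well defined (its integrand is integrable) on $H_0^1$, and there is a constant $C(\Omega)>0$ such that $$b(u,v,w)\le C(\Omega)\sqrt{\|u\|\,\|\nabla u\|}\;\|\nabla v\|\,\|\nabla w\|\qquad\text{for all } u,v,w\in H_0^1. \tag{1}$$ Let $C(\Omega)>0$ be any constant for which (1) holds. Let $Re>0$, $\Delta t>0$, $M,d\in\mathbb N$, let $\varphi_1,\dots,\varphi_d\in H_0^1$ be $L^2$-orthonormal and divergence-free, and let $f^n\in[L^2(\Omega)]^q$. For $r\le d$ put $X^r=\operatorname{span}\{\varphi_1,\dots,\varphi_r\}$, $P_r g=\sum_{i\le r}(g,\varphi_i)\varphi_i$ and $Q_r g=\sum_{r<i\le d}(g,\varphi_i)\varphi_i$. Truth solution: $u_d^0,\dots,u_d^M\in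 X^d$ satisfy, for $n=1,\dots,M$ and all $v\in X^d$, $$\Big(\tfrac{u_d^n-u_d^{n-1}}{\Delta t},v\Big)+Re^{-1}(\nabla u_d^n,\nabla v)+b(u_d^n,u_d^n,v)=(f^n,v).$$ DD-VMS-ROM of dimension $r\le d$: $\tau^{ROM}$ is a map from $X^r$ to vector fields on $\Omega$ whose pairings with $\varphi_1,\dots,\varphi_r$ exist and satisfy $-(\tau^{ROM}(\sum_k a_k\varphi_k),\varphi_i)=(\widetilde A a)_i$ for all $a\in\mathbb R^r$, $i\le r$, for some $\widetilde A\in\mathbb R^{r\times r}$ with $a^T\widetilde A a\le 0$ for all $a\in\mathbb R^r$; and $u_r^0,\dots,u_r^M\in X^r$ satisfy $u_r^0=P_ru_d^0$ and, for $n=1,\dots,M$ and all $v\in X^r$, $$\Big(\tfrac{u_r^n-u_r^{n-1}}{\Delta t},v\Big)+Re^{-1}(\nabla u_r^n,\nabla v)+b(u_r^n,u_r^n,v)+(\tau^{ROM}(u_r^n),v)=(f^n,v).$$ Set $\tau^{FOM}(u_d^n)=u_d^n\cdot\nabla u_d^n-P_ru_d^n\cdot\nabla P_ru_d^n$, $e^n=P_ru_d^n-u_r^n$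 and $d_j=\frac{27Re^3C(\Omega)^4}{16}\|\nabla P_ru_d^j\|^4+Re$. (ii) Let $r\le d$. Suppose that the commutation error vanishes, i.e. $Re^{-1}(\nabla Q_ru_d^n,\nabla v)=0$ for all $v\in X^r$ and $n=1,\dots,M$, and that $\Delta t\,d_j<1$ for $j=1,\dots,M$. Then for all $n=1,\dots,M$ $$\|e^n\|^2+\Delta t\sum_{j=1}^nRe^{-1}\|\nabla e^j\|^2\le\exp\Big(\Delta t\sum_{j=1}^n\frac{d_j}{1-\Delta t\,d_j}\Big)\,\Delta t\sum_{j=1}^nRe^{-1}\big\|P_r\big(\tau^{FOM}(u_d^j)-\tau^{ROM}(P_ru_d^j)\big)\big\|^2 .$$ (iii) If the hypotheses of (ii) hold for every $r\le d$, then the DD-VMS-ROM is verifiable: there is a constant $K$, independent of $r$, $\widetilde A$, $\tau^{ROM}$, $u_r$ and $n$, such that for all $r\le d$, all such $\tau^{ROM}$ and $u_r$, and all $n=1,\dots,M$ $$\|P_ru_d^n-u_r^n\|^2\le K\,\frac1n\sum_{j=1}^n\big\|P_r\big(\tau^{FOM}(u_d^j)-\tau^{ROM}(P_ru_d^j)\big)\big\|^2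 .$$ -/

import Mathlib

open MeasureTheory Set
open scoped ContDiff RealInnerProductSpace

noncomputable section

namespace DDVMS

/-- Points of `ℝ^q` and values of velocity fields, with the Euclidean norm. -/
abbrev Vec (q : ℕ) := EuclideanSpace ℝ (Fin q)

/-- Values of gradients of velocity fields: the `i`-th entry is the partial derivative
`∂ᵢ u ∈ ℝ^q`. The norm is the Euclidean (Frobenius) norm of the Jacobian. -/
abbrev Grad (q : ℕ) := PiLp 2 (fun _ : Fin q => Vec q)

/-- `[L²(Ω)]^q`. -/
abbrev L2Vec {q : ℕ} (Ω : Set (Vec q)) := Lp (Vec q) 2 (volume.restrict Ω)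

/-- `[L²(Ω)]^{q×q}`. -/
abbrev L2Grad {q : ℕ} (Ω : Set (Vec q)) := Lp (Grad q) 2 (volume.restrict Ω)

/-- The classical gradient of a differentiable field. -/
def classicalGrad {q : ℕ} (ψ : Vec q → Vec q) (x : Vec q) : Grad q :=
  WithLp.toLp 2 (fun i => fderiv ℝ ψ x (EuclideanSpace.single i 1))

/-- The pairs `(ψ, ∇ψ)` in `L² × L²`, for `ψ ∈ [C_c^∞(Ω)]^q`. -/
def testPairs {q : ℕ} (Ω : Set (Vec q)) : Submodule ℝ (L2Vec Ω × L2Grad Ω) where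
  carrier := {p | ∃ ψ : Vec q → Vec q, ContDiff ℝ ∞ ψ ∧ HasCompactSupport ψ ∧ tsupport ψ ⊆ Ω ∧
    p.1 =ᵐ[volume.restrict Ω] ψ ∧ p.2 =ᵐ[volume.restrict Ω] classicalGrad ψ}
  add_mem' := by
    rintro a b ⟨ψ, h1, h2, h3, h4, h5⟩ ⟨χ, k1, k2, k3, k4, k5⟩
    refine ⟨ψ + χ, h1.add k1, h2.add k2,
      (tsupport_add ψ χ).trans (union_subset h3 k3), ?_, ?_⟩
    · exact (Lp.coeFn_add a.1 b.1).trans (h4.add k4)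
    · refine (Lp.coeFn_add a.2 b.2).trans ((h5.add k5).trans (.of_forall fun x => ?_))
      have hψ : DifferentiableAt ℝ ψ x := (h1.differentiable (by simp)) x
      have hχ : DifferentiableAt ℝ χ x := (k1.differentiable (by simp)) x
      ext i j
      simp [classicalGrad, fderiv_add hψ hχ]
  zero_mem' := by
    refine ⟨0, contDiff_const, HasCompactSupport.zero, by simp, Lp.coeFn_zero _ _ _, ?_⟩
    refine (Lp.coeFn_zero _ _ _).trans (.of_forall fun x => ?_)
    ext i j
    simp [classicalGrad]
  smul_mem' := by
    rintro c a ⟨ψ, h1, h2, h3, h4, h5⟩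
    refine ⟨c • ψ, h1.const_smul c, h2.smul_left (f := fun _ => c),
      (closure_mono (Function.support_const_smul_subset c ψ)).trans h3, ?_, ?_⟩
    · exact (Lp.coeFn_smul c a.1).trans (h4.const_smul c)
    · refine (Lp.coeFn_smul c a.2).trans ((h5.const_smul c).trans (.of_forall fun x => ?_))
      have hψ : DifferentiableAt ℝ ψ x := (h1.differentiable (by simp)) x
      ext i j
      simp [classicalGrad, fderiv_const_smul hψ]

/-- `[H_0^1(Ω)]^q`: the closure of `[C_c^∞(Ω)]^q` in the `H^1` norm. An element is the pair of a
field in `L²` and its weak gradient (which the field determines). -/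
def H01 {q : ℕ} (Ω : Set (Vec q)) : Submodule ℝ (L2Vec Ω × L2Grad Ω) :=
  (testPairs Ω).topologicalClosure

variable {q : ℕ} {Ω : Set (Vec q)} {d : ℕ}

/-- The field itself, as an element of `L²`. -/
def field (u : H01 Ω) : L2Vec Ω := u.1.1

/-- The weak gradient `∇u`. -/
def grad (u : H01 Ω) : L2Grad Ω := u.1.2

/-- `∇ · u = 0` almost everywhere in `Ω`. -/
def IsDivFree (u : H01 Ω) : Prop :=
  ∀ᵐ x ∂(volume.restrict Ω), ∑ i, grad u x i i = 0

/-- The pairing `(g, w) = ∫_Ω g · w`; the `L²` inner product when `g ∈ L²`. -/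
def pair (g : Vec q → Vec q) (w : H01 Ω) : ℝ := ∫ x in Ω, ⟪g x, field w x⟫

/-- `u · ∇v = ∑ᵢ uᵢ ∂ᵢ v`. -/
def conv (u v : H01 Ω) (x : Vec q) : Vec q := ∑ i, field u x i • grad v x i

/-- `b(u, v, w) = (u · ∇v, w)`. -/
def trilinear (u v w : H01 Ω) : ℝ := pair (conv u v) w

/-- `C` is an admissible constant `C(Ω)` in the bound
`b(u, v, w) ≤ C(Ω) √(‖u‖ ‖∇u‖) ‖∇v‖ ‖∇w‖` on `H_0^1(Ω)`. -/
def IsTrilinearConst (Ω : Set (Vec q)) (C : ℝ) : Prop :=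
  0 < C ∧ ∀ u v w : H01 Ω,
    trilinear u v w ≤ C * √(‖field u‖ * ‖grad u‖) * ‖grad v‖ * ‖grad w‖

/-- `X^r = span {φ_1, …, φ_r}`. -/
def romSpace (φ : Fin d → H01 Ω) (r : ℕ) : Submodule ℝ (H01 Ω) :=
  Submodule.span ℝ (φ '' {i | i.val < r})

/-- `P_r g = ∑_{i ≤ r} (g, φ_i) φ_i`. -/
def projP (φ : Fin d → H01 Ω) (r : ℕ) (g : Vec q → Vec q) : H01 Ω :=
  ∑ i : Fin d with i.val < r, pair g (φ i) • φ i

/-- `Q_r g = ∑_{r < i ≤ d} (g, φ_i) φ_i`. -/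
def projQ (φ : Fin d → H01 Ω) (r : ℕ) (g : Vec q → Vec q) : H01 Ω :=
  ∑ i : Fin d with r ≤ i.val, pair g (φ i) • φ i

/-- `u^1, …, u^M ∈ X^r` with `u^0 ∈ X^r` solve the backward Euler scheme
`((u^n - u^{n-1})/Δt, v) + Re⁻¹ (∇u^n, ∇v) + (u^n · ∇u^n, v) + (τ(u^n), v) = (f^n, v)`
for all `v ∈ X^r`. -/
def SolvesScheme (φ : Fin d → H01 Ω) (r : ℕ) (Re dt : ℝ) (f : ℕ → L2Vec Ω) (M : ℕ)
    (τ : H01 Ω → Vec q → Vec q) (u : ℕ → H01 Ω) : Prop :=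
  (∀ n ≤ M, u n ∈ romSpace φ r) ∧
  ∀ n < M, ∀ v ∈ romSpace φ r,
    ⟪dt⁻¹ • (field (u (n + 1)) - field (u n)), field v⟫ + Re⁻¹ * ⟪grad (u (n + 1)), grad v⟫
      + trilinear (u (n + 1)) (u (n + 1)) v + pair (τ (u (n + 1))) v
      = ⟪f (n + 1), field v⟫

/-- The truth solution: the `d`-dimensional Galerkin ROM (no closure term). -/
def IsTruthSolution (φ : Fin d → H01 Ω) (Re dt : ℝ) (f : ℕ → L2Vec Ω) (M : ℕ)
    (ud : ℕ → H01 Ω) : Prop :=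
  SolvesScheme φ d Re dt f M (fun _ _ => 0) ud

/-- The `r`-dimensional ROM with closure `τ` and initial condition `u_r^0 = P_r u_d^0`. -/
def IsROMSolution (φ : Fin d → H01 Ω) (r : ℕ) (Re dt : ℝ) (f : ℕ → L2Vec Ω) (M : ℕ)
    (ud : ℕ → H01 Ω) (τ : H01 Ω → Vec q → Vec q) (ur : ℕ → H01 Ω) : Prop :=
  ur 0 = projP φ r (field (ud 0)) ∧ SolvesScheme φ r Re dt f M τ ur

/-- `τ^FOM(u) = u · ∇u - P_r u · ∇ P_r u`. -/
def tauFOM (φ : Fin d → H01 Ω) (r : ℕ) (u : H01 Ω) (x : Vec q) : Vec q :=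
  conv u u x - conv (projP φ r (field u)) (projP φ r (field u)) x

/-- The projected closure error `P_r (τ^FOM(u) - τ^ROM(P_r u))`. -/
def closureError (φ : Fin d → H01 Ω) (r : ℕ) (τ : H01 Ω → Vec q → Vec q) (u : H01 Ω) : H01 Ω :=
  projP φ r (fun x => tauFOM φ r u x - τ (projP φ r (field u)) x)

/-- The commutation error `Re⁻¹ (∇Q_r u, ∇v)` vanishes for all `v ∈ X^r` along `u^1, …, u^M`. -/
def NoCommutationError (φ : Fin d → H01 Ω) (r : ℕ) (Re : ℝ) (M : ℕ) (ud : ℕ → H01 Ω) : Prop :=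
  ∀ n ∈ Finset.Icc 1 M, ∀ v ∈ romSpace φ r,
    Re⁻¹ * ⟪grad (projQ φ r (field (ud n))), grad v⟫ = 0

/-- The closure maps on `X^r` given by the linear ansatz
`-(τ(∑ₖ aₖ φₖ), φᵢ) = (Ã a)ᵢ`, `i = 1, …, r`, with `Ã` negative semidefinite
(`aᵀ Ã a ≤ 0` for all `a`; `Ã` need not be symmetric). The pairings are required to exist. -/
def linearClosures (φ : Fin d → H01 Ω) (r : ℕ) (hr : r ≤ d) : Set (H01 Ω → Vec q → Vec q) :=
  {τ | ∃ A : Matrix (Fin r) (Fin r) ℝ, (∀ a : Fin r → ℝ, a ⬝ᵥ A.mulVec a ≤ 0) ∧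
    ∀ (a : Fin r → ℝ) (i : Fin r),
      IntegrableOn
        (fun x => ⟪τ (∑ k, a k • φ (Fin.castLE hr k)) x, field (φ (Fin.castLE hr i)) x⟫) Ω ∧
      -pair (τ (∑ k, a k • φ (Fin.castLE hr k))) (φ (Fin.castLE hr i)) = A.mulVec a i}

/-- `d_j = (27 Re³ C⁴ / 16) ‖∇P_r u_d^j‖⁴ + Re`. -/
def gronwallCoeff (φ : Fin d → H01 Ω) (r : ℕ) (Re C : ℝ) (u : H01 Ω) : ℝ :=
  27 * Re ^ 3 * C ^ 4 / 16 * ‖grad (projP φ r (field u))‖ ^ 4 + Re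

/-- Verifiability in the `L²` norm of a family of closure models: `cl r hr` is the set of closure
maps that the family allows for the `r`-dimensional ROM. The constant `K` depends neither on `r`
nor on the closure map nor on the ROM solution. -/
def IsVerifiable (φ : Fin d → H01 Ω) (Re dt : ℝ) (f : ℕ → L2Vec Ω) (M : ℕ) (ud : ℕ → H01 Ω)
    (cl : ∀ r : ℕ, r ≤ d → Set (H01 Ω → Vec q → Vec q)) : Prop :=
  ∃ K : ℝ, ∀ (r : ℕ) (hr : r ≤ d), ∀ τ ∈ cl r hr, ∀ ur : ℕ → H01 Ω,
    IsROMSolution φ r Re dt f M ud τ ur → ∀ n ∈ Finset.Icc 1 M,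
      ‖field (projP φ r (field (ud n)) - ur n)‖ ^ 2 ≤
        K * ((n : ℝ)⁻¹ * ∑ j ∈ Finset.Icc 1 n, ‖field (closureError φ r τ (ud j))‖ ^ 2)

end DDVMS

end

open Filter Topology
open scoped ENNReal NNReal

noncomputable section

namespace DDVMS

variable {q : ℕ} {Ω : Set (Vec q)}

/-! The estimate is an energy argument for `e = P_r u_d - u_r`. Both schemes are tested with `e`,
which lies in `X^r ⊆ X^d`, and subtracted. Orthonormality removes `Q_r u_d` from the time
difference, and the commutation hypothesis removes it from the viscous term. By definition of
`tauFOM`, the convective difference is `b(P,P,e) - b(u_r,u_r,e)` plus a closure error, where `P =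
P_r u_d`.

Three structural facts then act. First, `b(P,P,e) - b(u_r,u_r,e) = b(e,P,e) + b(u_r,e,e)`, and the
last term vanishes because `u_r` is divergence-free (`trilinear_self_eq_zero`). Second,
semidefiniteness of `Ã` makes the closure monotone, so its increment has a good sign
(`closure_monotone`). Third, the trilinear bound and Young's inequality absorb `b(e,P,e)` into the
viscosity, leaving the factor `d_j` (`energy_ineq_of_tested`). The implicit Gronwall inequality sums
the steps from `e^0 = 0`.

The analytic input is the embedding of `H_0^1` in `L⁶`, valid for `q = 2, 3`. With Hölder it gives
integrability, the constant `C(Ω)`, and the continuity of `b` needed to pass from test fields to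
`H_0^1`. -/

/-! ### Density of test fields and the Sobolev inequality. -/

/-- Every element of `H_0^1` is an `H^1` limit of test fields. -/
theorem exists_seq_testPairs (u : H01 Ω) :
    ∃ s : ℕ → H01 Ω, (∀ n, (s n).1 ∈ testPairs Ω) ∧ Tendsto s atTop (𝓝 u) := by
  obtain ⟨x, hx, hlim⟩ := mem_closure_iff_seq_limit.1 u.2
  exact ⟨fun n => ⟨x n, (testPairs Ω).le_topologicalClosure (hx n)⟩, hx,
    tendsto_subtype_rng.2 hlim⟩

theorem continuous_field : Continuous (field : H01 Ω → L2Vec Ω) :=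
  continuous_fst.comp continuous_subtype_val

theorem continuous_grad : Continuous (grad : H01 Ω → L2Grad Ω) :=
  continuous_snd.comp continuous_subtype_val

/-- Converts the operator norm, in which the Gagliardo–Nirenberg–Sobolev inequality is phrased, to
the Frobenius norm of `Grad`; the crude factor `q` is harmless. -/
theorem norm_fderiv_le_classicalGrad (ψ : Vec q → Vec q) (x : Vec q) :
    ‖fderiv ℝ ψ x‖ ≤ q * ‖classicalGrad ψ x‖ := by
  refine ContinuousLinearMap.opNorm_le_bound _ (by positivity) fun v => ?_
  have hv : v = ∑ i, v i • EuclideanSpace.single i (1 : ℝ) := by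
    ext j
    simp [Finset.sum_apply, Pi.single_apply]
  have hD : fderiv ℝ ψ x v = ∑ i, v i • classicalGrad ψ x i := by
    conv_lhs => rw [hv]
    simp [classicalGrad]
  rw [hD]
  calc ‖∑ i, v i • classicalGrad ψ x i‖ ≤ ∑ i, ‖v i • classicalGrad ψ x i‖ := norm_sum_le _ _
    _ ≤ ∑ _i : Fin q, ‖v‖ * ‖classicalGrad ψ x‖ := by
        gcongr with i
        rw [norm_smul]
        gcongr
        · exact PiLp.norm_apply_le v i
        · exact PiLp.norm_apply_le (classicalGrad ψ x) i
    _ = q * ‖classicalGrad ψ x‖ * ‖v‖ := by simp; ring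

/-- The Sobolev inequality `‖u‖_{L⁶} ≤ K ‖∇u‖` for test fields. -/
theorem exists_eLpNorm_six_le_of_testPairs (hq : q = 2 ∨ q = 3) (hΩb : Bornology.IsBounded Ω) :
    ∃ K : ℝ≥0, ∀ u : H01 Ω, u.1 ∈ testPairs Ω →
      eLpNorm (field u) 6 (volume.restrict Ω) ≤ K * eLpNorm (grad u) 2 (volume.restrict Ω) := by
  have hfin : IsFiniteMeasure (volume.restrict Ω) :=
    ⟨by simpa using hΩb.measure_lt_top⟩
  -- The Sobolev inequality into `L⁶` needs `p < q` and `1/p - 1/q ≤ 1/6`. In dimension 3, `p = 2`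
  -- is exactly critical; in dimension 2, `p = 2` is excluded and `p = 3/2` is critical.
  obtain ⟨p, hp1, hpq, hp2, hps⟩ : ∃ p : ℝ≥0, 1 ≤ p ∧ p < q ∧ p ≤ 2 ∧
      (p : ℝ)⁻¹ - (q : ℝ)⁻¹ ≤ ((6 : ℝ≥0) : ℝ)⁻¹ := by
    rcases hq with rfl | rfl
    · refine ⟨3 / 2, ?_, ?_, ?_, ?_⟩
      · rw [← NNReal.coe_le_coe]; push_cast; norm_num
      · rw [← NNReal.coe_lt_coe]; push_cast; norm_num
      · rw [← NNReal.coe_le_coe]; push_cast; norm_num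
      · push_cast; norm_num
    · refine ⟨2, ?_, ?_, le_rfl, ?_⟩
      · rw [← NNReal.coe_le_coe]; push_cast; norm_num
      · rw [← NNReal.coe_lt_coe]; push_cast; norm_num
      · push_cast; norm_num
  set C := eLpNormLESNormFDerivOfLeConst (Vec q) (volume : Measure (Vec q)) Ω p 6 with hC
  -- Hölder factor `|Ω|^(1/p - 1/2)` for passing from `L^p` to `L²`; boundedness of `Ω` makes it
  -- finite.
  set c : ℝ≥0∞ := (volume.restrict Ω) univ ^ (1 / (p : ℝ) - 1 / 2) with hc
  have hctop : c ≠ ⊤ := by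
    refine ENNReal.rpow_ne_top_of_nonneg ?_ (measure_ne_top _ _)
    have : (0 : ℝ) < p := lt_of_lt_of_le one_pos (by exact_mod_cast hp1)
    have h2 : (p : ℝ) ≤ 2 := by exact_mod_cast hp2
    have := one_div_le_one_div_of_le this h2
    linarith
  refine ⟨C * (q * c.toNNReal), ?_⟩
  rintro u ⟨ψ, h1, h2, h3, h4, h5⟩
  have h1' : ContDiff ℝ 1 ψ := h1.of_le (by simp)
  have hD : Continuous (fderiv ℝ ψ) := h1'.continuous_fderiv one_ne_zero
  have hG : AEStronglyMeasurable (classicalGrad ψ) (volume.restrict Ω) :=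
    (Lp.aestronglyMeasurable u.1.2).congr h5
  have hsup : Function.support ψ ⊆ Ω := (subset_tsupport ψ).trans h3
  have hsup' : Function.support (fderiv ℝ ψ) ⊆ Ω := (support_fderiv_subset ℝ).trans h3
  have e1 : eLpNorm (field u) 6 (volume.restrict Ω) = eLpNorm ψ 6 volume := by
    rw [← eLpNorm_restrict_eq_of_support_subset hsup]
    exact eLpNorm_congr_ae h4
  have e2 : eLpNorm (grad u) 2 (volume.restrict Ω)
      = eLpNorm (classicalGrad ψ) 2 (volume.restrict Ω) := eLpNorm_congr_ae h5
  have gns : eLpNorm ψ 6 volume ≤ C * eLpNorm (fderiv ℝ ψ) p volume := by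
    have := eLpNorm_le_eLpNorm_fderiv_of_le (volume : Measure (Vec q)) (u := ψ) (s := Ω) (p := p)
      (q := 6) h1' hsup hp1 (by simpa using hpq) (by simpa using hps) hΩb
    exact_mod_cast this
  rw [e1, e2]
  refine gns.trans ?_
  rw [← eLpNorm_restrict_eq_of_support_subset (f := fderiv ℝ ψ) hsup']
  have s1 : eLpNorm (fderiv ℝ ψ) p (volume.restrict Ω)
      ≤ (q : ℝ≥0) • eLpNorm (classicalGrad ψ) p (volume.restrict Ω) := by
    refine eLpNorm_le_nnreal_smul_eLpNorm_of_ae_le_mul (.of_forall fun x => ?_) _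
    rw [← NNReal.coe_le_coe]
    simpa using norm_fderiv_le_classicalGrad ψ x
  have s2 : eLpNorm (classicalGrad ψ) p (volume.restrict Ω)
      ≤ eLpNorm (classicalGrad ψ) 2 (volume.restrict Ω) * c := by
    have := eLpNorm_le_eLpNorm_mul_rpow_measure_univ (μ := volume.restrict Ω)
      (p := (p : ℝ≥0∞)) (q := 2) (by exact_mod_cast hp2) hG
    simpa [hc] using this
  push_cast
  rw [ENNReal.coe_toNNReal hctop]
  calc (C : ℝ≥0∞) * eLpNorm (fderiv ℝ ψ) p (volume.restrict Ω)
      ≤ C * (q * (eLpNorm (classicalGrad ψ) 2 (volume.restrict Ω) * c)) := by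
        gcongr
        refine s1.trans ?_
        rw [ENNReal.smul_def, smul_eq_mul]
        push_cast
        gcongr
    _ = _ := by ring

/-- The Sobolev inequality `‖u‖_{L⁶} ≤ K ‖∇u‖` on `H_0^1`. -/
theorem exists_eLpNorm_six_le (hq : q = 2 ∨ q = 3) (hΩb : Bornology.IsBounded Ω) :
    ∃ K : ℝ≥0, ∀ u : H01 Ω,
      eLpNorm (field u) 6 (volume.restrict Ω) ≤ K * eLpNorm (grad u) 2 (volume.restrict Ω) := by
  obtain ⟨K, hK⟩ := exists_eLpNorm_six_le_of_testPairs hq hΩb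
  refine ⟨K, fun u => ?_⟩
  obtain ⟨s, hs, hlim⟩ := exists_seq_testPairs u
  have hf := ((continuous_field.tendsto u).comp hlim)
  have hg := ((continuous_grad.tendsto u).comp hlim)
  -- `L²` convergence gives an almost everywhere convergent subsequence, along which the `L⁶` norm
  -- is lower semicontinuous by Fatou.
  obtain ⟨ns, hns, hae⟩ := (tendstoInMeasure_of_tendsto_Lp hf).exists_seq_tendsto_ae
  refine (Lp.eLpNorm_lim_le_liminf_eLpNorm (p := 6)
    (fun n => Lp.aestronglyMeasurable (field (s (ns n)))) (field u) hae).trans ?_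
  have hg' : Tendsto (fun n => (K : ℝ≥0∞) * ‖grad (s (ns n))‖ₑ) atTop (𝓝 (K * ‖grad u‖ₑ)) :=
    ENNReal.Tendsto.const_mul ((hg.comp hns.tendsto_atTop).enorm) (.inr ENNReal.coe_ne_top)
  rw [← Lp.enorm_def, ← hg'.liminf_eq]
  refine liminf_le_liminf (.of_forall fun n => ?_)
  rw [Lp.enorm_def]
  exact hK _ (hs _)

/-! ### The trilinear bound and integrability. -/

/-- A Hölder inequality with exponents `3, 2, 6`, where the `L³` norm of the first factor is
interpolated between `L²` and `L⁶`. -/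
theorem lintegral_mul_mul_le_eLpNorm {α E F G : Type*} [MeasurableSpace α] {μ : Measure α}
    [NormedAddCommGroup E] [NormedAddCommGroup F] [NormedAddCommGroup G]
    {f : α → E} {g : α → F} {h : α → G}
    (hf : AEStronglyMeasurable f μ) (hg : AEStronglyMeasurable g μ)
    (hh : AEStronglyMeasurable h μ) :
    ∫⁻ x, ‖f x‖ₑ * ‖g x‖ₑ * ‖h x‖ₑ ∂μ ≤
      (eLpNorm f 2 μ) ^ (1 / 2 : ℝ) * (eLpNorm f 6 μ) ^ (1 / 2 : ℝ)
        * eLpNorm g 2 μ * eLpNorm h 6 μ := by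
  -- Split `|f| = (|f|²)^(1/4) (|f|⁶)^(1/12)`, `|g| = (|g|²)^(1/2)`, `|h| = (|h|⁶)^(1/6)`; the four
  -- weights sum to 1.
  have key := ENNReal.lintegral_prod_norm_pow_le (μ := μ) (Finset.univ : Finset (Fin 4))
    (f := ![fun x => ‖f x‖ₑ ^ (2 : ℝ), fun x => ‖f x‖ₑ ^ (6 : ℝ), fun x => ‖g x‖ₑ ^ (2 : ℝ),
      fun x => ‖h x‖ₑ ^ (6 : ℝ)]) (p := ![1 / 4, 1 / 12, 1 / 2, 1 / 6])
    (by
      intro i _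
      fin_cases i
      · exact hf.enorm.pow_const _
      · exact hf.enorm.pow_const _
      · exact hg.enorm.pow_const _
      · exact hh.enorm.pow_const _)
    (by simp [Fin.sum_univ_four]; norm_num)
    (by intro i _; fin_cases i <;> norm_num)
  have h6 : eLpNorm f 6 μ = (∫⁻ x, ‖f x‖ₑ ^ (6 : ℝ) ∂μ) ^ (1 / 6 : ℝ) := by
    rw [eLpNorm_eq_lintegral_rpow_enorm_toReal (by norm_num) (by norm_num)]
    norm_num
  have h2 : eLpNorm f 2 μ = (∫⁻ x, ‖f x‖ₑ ^ (2 : ℝ) ∂μ) ^ (1 / 2 : ℝ) := by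
    rw [eLpNorm_eq_lintegral_rpow_enorm_toReal (by norm_num) (by norm_num)]
    norm_num
  have h6' : eLpNorm h 6 μ = (∫⁻ x, ‖h x‖ₑ ^ (6 : ℝ) ∂μ) ^ (1 / 6 : ℝ) := by
    rw [eLpNorm_eq_lintegral_rpow_enorm_toReal (by norm_num) (by norm_num)]
    norm_num
  have h2' : eLpNorm g 2 μ = (∫⁻ x, ‖g x‖ₑ ^ (2 : ℝ) ∂μ) ^ (1 / 2 : ℝ) := by
    rw [eLpNorm_eq_lintegral_rpow_enorm_toReal (by norm_num) (by norm_num)]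
    norm_num
  rw [h2, h6, h2', h6', ← ENNReal.rpow_mul, ← ENNReal.rpow_mul]
  simp only [Fin.prod_univ_four, Matrix.cons_val] at key
  convert key using 1
  · refine lintegral_congr fun x => ?_
    simp only [← ENNReal.rpow_mul]
    rw [← ENNReal.rpow_add_of_nonneg _ _ (by norm_num) (by norm_num)]
    norm_num
  · norm_num

theorem enorm_inner_sum_smul_le (a : Vec q) (G : Grad q) (b : Vec q) :
    ‖⟪∑ i, a i • G i, b⟫‖ₑ ≤ q * (‖a‖ₑ * ‖G‖ₑ * ‖b‖ₑ) := by
  have : ‖⟪∑ i, a i • G i, b⟫‖ ≤ q * (‖a‖ * ‖G‖ * ‖b‖) := by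
    calc ‖⟪∑ i, a i • G i, b⟫‖ ≤ ‖∑ i, a i • G i‖ * ‖b‖ := norm_inner_le_norm _ _
      _ ≤ (∑ _i : Fin q, ‖a‖ * ‖G‖) * ‖b‖ := by
          gcongr
          refine (norm_sum_le _ _).trans (Finset.sum_le_sum fun i _ => ?_)
          rw [norm_smul]
          gcongr
          · exact PiLp.norm_apply_le a i
          · exact PiLp.norm_apply_le G i
      _ = q * (‖a‖ * ‖G‖ * ‖b‖) := by simp; ring
  have h := ENNReal.ofReal_le_ofReal this
  rwa [ENNReal.ofReal_mul (by positivity), ENNReal.ofReal_mul (by positivity),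
    ENNReal.ofReal_mul (by positivity), ofReal_norm, ofReal_norm, ofReal_norm, ofReal_norm,
    ENNReal.ofReal_natCast] at h

theorem aestronglyMeasurable_conv (u v : H01 Ω) :
    AEStronglyMeasurable (conv u v) (volume.restrict Ω) := by
  have h : ∀ i : Fin q, AEStronglyMeasurable (fun x => field u x i • grad v x i)
      (volume.restrict Ω) := fun i =>
    ((PiLp.continuous_apply 2 (fun _ : Fin q => ℝ) i).comp_aestronglyMeasurable
        (Lp.aestronglyMeasurable (field u))).smul
      ((PiLp.continuous_apply 2 (fun _ : Fin q => Vec q) i).comp_aestronglyMeasurable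
        (Lp.aestronglyMeasurable (grad v)))
  exact Finset.aestronglyMeasurable_fun_sum _ fun i _ => h i

/-- Bounding the lower integral of the absolute value serves twice: its finiteness is integrability,
and its size is the constant `C(Ω)`. -/
theorem exists_lintegral_conv_le (hq : q = 2 ∨ q = 3) (hΩb : Bornology.IsBounded Ω) :
    ∃ K : ℝ≥0, ∀ u v w : H01 Ω,
      ∫⁻ x in Ω, ‖⟪conv u v x, field w x⟫‖ₑ ≤
        K * (‖field u‖ₑ * ‖grad u‖ₑ) ^ (1 / 2 : ℝ) * ‖grad v‖ₑ * ‖grad w‖ₑ := by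
  obtain ⟨K, hK⟩ := exists_eLpNorm_six_le hq hΩb
  refine ⟨q * (K ^ (1 / 2 : ℝ) * K), fun u v w => ?_⟩
  have hu := hK u
  have hw := hK w
  calc ∫⁻ x in Ω, ‖⟪conv u v x, field w x⟫‖ₑ
      ≤ ∫⁻ x in Ω, q * (‖field u x‖ₑ * ‖grad v x‖ₑ * ‖field w x‖ₑ) :=
        lintegral_mono fun x => enorm_inner_sum_smul_le _ _ _
    _ = q * ∫⁻ x in Ω, ‖field u x‖ₑ * ‖grad v x‖ₑ * ‖field w x‖ₑ :=
        lintegral_const_mul' _ _ (ENNReal.natCast_ne_top q)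
    _ ≤ q * ((eLpNorm (field u) 2 (volume.restrict Ω)) ^ (1 / 2 : ℝ)
          * (K * eLpNorm (grad u) 2 (volume.restrict Ω)) ^ (1 / 2 : ℝ)
          * eLpNorm (grad v) 2 (volume.restrict Ω)
          * (K * eLpNorm (grad w) 2 (volume.restrict Ω))) := by
        gcongr
        refine (lintegral_mul_mul_le_eLpNorm (Lp.aestronglyMeasurable (field u))
          (Lp.aestronglyMeasurable (grad v)) (Lp.aestronglyMeasurable (field w))).trans ?_
        gcongr
    _ = _ := by
        simp only [← Lp.enorm_def]
        rw [ENNReal.mul_rpow_of_nonneg _ _ (by norm_num), ENNReal.mul_rpow_of_nonneg _ _ (by norm_num)]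
        push_cast
        rw [ENNReal.coe_rpow_of_nonneg _ (by norm_num)]
        ring

theorem integrableOn_conv (hq : q = 2 ∨ q = 3) (hΩb : Bornology.IsBounded Ω) (u v w : H01 Ω) :
    IntegrableOn (fun x => ⟪conv u v x, field w x⟫) Ω := by
  obtain ⟨K, hK⟩ := exists_lintegral_conv_le hq hΩb
  refine ⟨(aestronglyMeasurable_conv u v).inner (Lp.aestronglyMeasurable _),
    (hK u v w).trans_lt ?_⟩
  have := ENNReal.rpow_ne_top_of_nonneg (y := 1 / 2) (by norm_num)
    (ENNReal.mul_ne_top (enorm_ne_top (x := field u)) (enorm_ne_top (x := grad u)))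
  exact (ENNReal.mul_ne_top (ENNReal.mul_ne_top (ENNReal.mul_ne_top ENNReal.coe_ne_top this)
    enorm_ne_top) enorm_ne_top).lt_top

/-- The bound on the trilinear form, with absolute values. -/
theorem exists_abs_trilinear_le (hq : q = 2 ∨ q = 3) (hΩb : Bornology.IsBounded Ω) :
    ∃ C : ℝ, 0 < C ∧ ∀ u v w : H01 Ω,
      |trilinear u v w| ≤ C * √(‖field u‖ * ‖grad u‖) * ‖grad v‖ * ‖grad w‖ := by
  obtain ⟨K, hK⟩ := exists_lintegral_conv_le hq hΩb
  -- The `+ 1` only secures strict positivity, since `K` may be 0.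
  refine ⟨K + 1, by positivity, fun u v w => ?_⟩
  have h := (enorm_integral_le_lintegral_enorm (μ := volume.restrict Ω)
    (fun x => ⟪conv u v x, field w x⟫)).trans (hK u v w)
  have h2 : ‖trilinear u v w‖ₑ ≤
      ENNReal.ofReal (K * √(‖field u‖ * ‖grad u‖) * ‖grad v‖ * ‖grad w‖) := by
    rw [ENNReal.ofReal_mul (by positivity), ENNReal.ofReal_mul (by positivity),
      ENNReal.ofReal_mul (by positivity), Real.sqrt_eq_rpow,
      ← ENNReal.ofReal_rpow_of_nonneg (by positivity) (by norm_num),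
      ENNReal.ofReal_mul (by positivity), ofReal_norm, ofReal_norm, ofReal_norm, ofReal_norm,
      ENNReal.ofReal_coe_nnreal]
    exact h
  rw [← ofReal_norm, ENNReal.ofReal_le_ofReal_iff (by positivity)] at h2
  refine h2.trans ?_
  gcongr
  simp

theorem exists_isTrilinearConst (hq : q = 2 ∨ q = 3) (hΩb : Bornology.IsBounded Ω) :
    ∃ C : ℝ, IsTrilinearConst Ω C := by
  obtain ⟨C, hC, h⟩ := exists_abs_trilinear_le hq hΩb
  exact ⟨C, hC, fun u v w => (le_abs_self _).trans (h u v w)⟩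

/-! ### Linearity and continuity of the trilinear form. -/

theorem field_sub (u v : H01 Ω) : field (u - v) = field u - field v := rfl
theorem grad_sub (u v : H01 Ω) : grad (u - v) = grad u - grad v := rfl
theorem field_neg (u : H01 Ω) : field (-u) = -field u := rfl
theorem grad_neg (u : H01 Ω) : grad (-u) = -grad u := rfl

theorem field_smul (c : ℝ) (v : H01 Ω) : field (c • v) = c • field v := rfl

theorem field_sum {ι : Type*} (s : Finset ι) (v : ι → H01 Ω) :
    field (∑ i ∈ s, v i) = ∑ i ∈ s, field (v i) :=
  map_sum ((LinearMap.fst ℝ _ _).comp (H01 Ω).subtype) v s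

theorem grad_add (u v : H01 Ω) : grad (u + v) = grad u + grad v := rfl

/-- Additivity of the Bochner integral requires both integrands to be integrable, which is why the
geometric hypotheses enter here and in the next two lemmas. -/
theorem trilinear_sub_left (hq : q = 2 ∨ q = 3) (hΩb : Bornology.IsBounded Ω)
    (u u' v w : H01 Ω) : trilinear (u - u') v w = trilinear u v w - trilinear u' v w := by
  rw [trilinear, trilinear, trilinear, pair, pair, pair,
    ← integral_sub (integrableOn_conv hq hΩb u v w) (integrableOn_conv hq hΩb u' v w)]
  refine integral_congr_ae ?_
  filter_upwards [Lp.coeFn_sub (field u) (field u')] with x hx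
  simp only [conv, field_sub, hx, Pi.sub_apply, PiLp.sub_apply, sub_smul,
    Finset.sum_sub_distrib, inner_sub_left]

theorem trilinear_sub_mid (hq : q = 2 ∨ q = 3) (hΩb : Bornology.IsBounded Ω)
    (u v v' w : H01 Ω) : trilinear u (v - v') w = trilinear u v w - trilinear u v' w := by
  rw [trilinear, trilinear, trilinear, pair, pair, pair,
    ← integral_sub (integrableOn_conv hq hΩb u v w) (integrableOn_conv hq hΩb u v' w)]
  refine integral_congr_ae ?_
  filter_upwards [Lp.coeFn_sub (grad v) (grad v')] with x hx
  simp only [conv, grad_sub, hx, Pi.sub_apply, PiLp.sub_apply, smul_sub,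
    Finset.sum_sub_distrib, inner_sub_left]

theorem trilinear_sub_right (hq : q = 2 ∨ q = 3) (hΩb : Bornology.IsBounded Ω)
    (u v w w' : H01 Ω) : trilinear u v (w - w') = trilinear u v w - trilinear u v w' := by
  rw [trilinear, trilinear, trilinear, pair, pair, pair,
    ← integral_sub (integrableOn_conv hq hΩb u v w) (integrableOn_conv hq hΩb u v w')]
  refine integral_congr_ae ?_
  filter_upwards [Lp.coeFn_sub (field w) (field w')] with x hx
  simp only [field_sub, hx, Pi.sub_apply, inner_sub_right]

theorem trilinear_neg_left (u v w : H01 Ω) : trilinear (-u) v w = -trilinear u v w := by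
  rw [trilinear, trilinear, pair, pair, ← integral_neg]
  refine integral_congr_ae ?_
  filter_upwards [Lp.coeFn_neg (field u)] with x hx
  simp only [conv, field_neg, hx, Pi.neg_apply, PiLp.neg_apply, neg_smul,
    Finset.sum_neg_distrib, inner_neg_left]

/-- Used to approximate the last two arguments by test fields while `u` stays fixed. -/
theorem tendsto_trilinear_diag (hq : q = 2 ∨ q = 3) (hΩb : Bornology.IsBounded Ω)
    (u w : H01 Ω) {s : ℕ → H01 Ω} (hs : Tendsto s atTop (𝓝 w)) :
    Tendsto (fun n => trilinear u (s n) (s n)) atTop (𝓝 (trilinear u w w)) := by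
  obtain ⟨C, hC, h⟩ := exists_abs_trilinear_le hq hΩb
  rw [tendsto_iff_norm_sub_tendsto_zero]
  have hgrad := (continuous_grad.tendsto w).comp hs
  have h1 : Tendsto (fun n => ‖grad (s n) - grad w‖) atTop (𝓝 0) :=
    tendsto_iff_norm_sub_tendsto_zero.1 hgrad
  set c := C * √(‖field u‖ * ‖grad u‖)
  have h2 : Tendsto (fun n => c * ‖grad (s n) - grad w‖ * ‖grad (s n)‖
      + c * ‖grad w‖ * ‖grad (s n) - grad w‖) atTop (𝓝 0) := by
    simpa using ((h1.const_mul c).mul hgrad.norm).add (h1.const_mul (c * ‖grad w‖))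
  refine squeeze_zero (fun _ => norm_nonneg _) (fun n => ?_) h2
  have e : trilinear u (s n) (s n) - trilinear u w w
      = trilinear u (s n - w) (s n) + trilinear u w (s n - w) := by
    rw [trilinear_sub_mid hq hΩb, trilinear_sub_right hq hΩb]; ring
  rw [e]
  exact (norm_add_le _ _).trans (add_le_add (h _ _ _) (h _ _ _))

/-! ### Skew-symmetry for divergence-free transport fields. -/

/-- The gradient of a scalar function, as a vector. -/
def scalarGrad (g : Vec q → ℝ) (x : Vec q) : Vec q :=
  WithLp.toLp 2 (fun i => fderiv ℝ g x (EuclideanSpace.single i 1))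

/-- The scalar matrix `g I`. -/
def scalarId (g : Vec q → ℝ) (x : Vec q) : Grad q :=
  WithLp.toLp 2 (fun i => g x • EuclideanSpace.single i 1)

theorem inner_scalarGrad (g : Vec q → ℝ) (x a : Vec q) :
    ⟪scalarGrad g x, a⟫ = ∑ i, a i * fderiv ℝ g x (EuclideanSpace.single i 1) := by
  simp [scalarGrad, PiLp.inner_apply]

theorem inner_scalarId (g : Vec q → ℝ) (x : Vec q) (G : Grad q) :
    ⟪scalarId g x, G⟫ = g x * ∑ i, G i i := by
  rw [PiLp.inner_apply, Finset.mul_sum]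
  refine Finset.sum_congr rfl fun i _ => ?_
  simp [scalarId, real_inner_smul_left, EuclideanSpace.inner_single_left]

theorem memLp_scalarGrad {g : Vec q → ℝ} (hg : ContDiff ℝ 1 g) (hc : HasCompactSupport g) :
    MemLp (scalarGrad g) 2 (volume.restrict Ω) := by
  have h1 : Continuous (scalarGrad g) :=
    (PiLp.continuous_toLp 2 _).comp (continuous_pi fun i =>
      (hg.continuous_fderiv one_ne_zero).clm_apply continuous_const)
  have h2 : HasCompactSupport (scalarGrad g) := by
    refine (hc.fderiv ℝ).mono fun x hx => ?_
    contrapose! hx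
    have : fderiv ℝ g x = 0 := by simpa using hx
    simp only [Function.mem_support, not_not]
    ext i
    simp [scalarGrad, this]
  exact (h1.memLp_of_hasCompactSupport h2).restrict Ω

theorem memLp_scalarId {g : Vec q → ℝ} (hg : Continuous g) (hc : HasCompactSupport g) :
    MemLp (scalarId g) 2 (volume.restrict Ω) := by
  have h1 : Continuous (scalarId g) :=
    (PiLp.continuous_toLp 2 _).comp (continuous_pi fun i => hg.smul continuous_const)
  have h2 : HasCompactSupport (scalarId g) := by
    refine hc.mono fun x hx => ?_
    contrapose! hx
    have : g x = 0 := by simpa using hx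
    simp only [Function.mem_support, not_not]
    ext i
    simp [scalarId, this]
  exact (h1.memLp_of_hasCompactSupport h2).restrict Ω

/-- Coordinatewise integration by parts on the whole space; compact support of `g` alone makes every
product integrable. -/
theorem integral_inner_scalarGrad_of_test {g : Vec q → ℝ} (hg : ContDiff ℝ ∞ g)
    (hc : HasCompactSupport g) {ψ : Vec q → Vec q} (hψ : ContDiff ℝ ∞ ψ) :
    ∫ x, ⟪scalarGrad g x, ψ x⟫ = -∫ x, ⟪scalarId g x, classicalGrad ψ x⟫ := by
  have dg : Differentiable ℝ g := hg.differentiable (by simp)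
  have dψ : Differentiable ℝ ψ := hψ.differentiable (by simp)
  have cg : Continuous (fderiv ℝ g) := hg.continuous_fderiv (by simp)
  have cψ : Continuous (fderiv ℝ ψ) := hψ.continuous_fderiv (by simp)
  have comp : ∀ (i : Fin q) x v, fderiv ℝ (fun y => ψ y i) x v = fderiv ℝ ψ x v i := by
    intro i x v
    have := ((EuclideanSpace.proj (𝕜 := ℝ) i).hasFDerivAt.comp x (dψ x).hasFDerivAt).fderiv
    have h2 := congrArg (fun L => L v) this
    simpa [Function.comp_def] using h2
  have ci : ∀ i : Fin q, Continuous fun x => ψ x i := fun i =>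
    (PiLp.continuous_apply 2 _ i).comp hψ.continuous
  have i1 : ∀ i : Fin q, Integrable fun x => ψ x i * fderiv ℝ g x (EuclideanSpace.single i 1) :=
    fun i => ((ci i).mul (cg.clm_apply continuous_const)).integrable_of_hasCompactSupport
      (HasCompactSupport.mul_left (hc.fderiv_apply ℝ _))
  have i2 : ∀ i : Fin q, Integrable fun x =>
      fderiv ℝ ψ x (EuclideanSpace.single i 1) i * g x := fun i =>
    (((PiLp.continuous_apply 2 _ i).comp (cψ.clm_apply continuous_const)).mul
      hg.continuous).integrable_of_hasCompactSupport hc.mul_left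
  have i3 : ∀ i : Fin q, Integrable fun x => ψ x i * g x := fun i =>
    ((ci i).mul hg.continuous).integrable_of_hasCompactSupport hc.mul_left
  have e1 : ∀ x, ⟪scalarId g x, classicalGrad ψ x⟫
      = ∑ i, fderiv ℝ ψ x (EuclideanSpace.single i 1) i * g x := fun x => by
    rw [inner_scalarId, Finset.mul_sum]
    exact Finset.sum_congr rfl fun i _ => mul_comm _ _
  simp only [inner_scalarGrad, e1]
  rw [integral_finsetSum _ fun i _ => i1 i, integral_finsetSum _ fun i _ => i2 i,
    ← Finset.sum_neg_distrib]
  refine Finset.sum_congr rfl fun i _ => ?_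
  have := integral_mul_fderiv_eq_neg_fderiv_mul_of_integrable (μ := volume)
    (f := fun x => ψ x i) (g := g) (v := EuclideanSpace.single i 1)
    (by simpa only [comp] using i2 i) (i1 i) (i3 i)
    (fun x _ => ((EuclideanSpace.proj (𝕜 := ℝ) i).differentiableAt.comp x (dψ x)))
    (fun x _ => dg x)
  simpa only [comp] using this

/-- `∫_Ω u · ∇g = -∫_Ω g ∇·u` for `u ∈ H_0^1` and a smooth compactly supported `g`. -/
theorem integral_inner_scalarGrad {g : Vec q → ℝ} (hg : ContDiff ℝ ∞ g)
    (hc : HasCompactSupport g) (u : H01 Ω) :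
    ∫ x in Ω, ⟪scalarGrad g x, field u x⟫ = -∫ x in Ω, ⟪scalarId g x, grad u x⟫ := by
  have m1 : MemLp (scalarGrad g) 2 (volume.restrict Ω) :=
    memLp_scalarGrad (hg.of_le (by simp)) hc
  have m2 : MemLp (scalarId g) 2 (volume.restrict Ω) := memLp_scalarId hg.continuous hc
  have e1 : ∀ u : H01 Ω, ⟪m1.toLp, field u⟫ = ∫ x in Ω, ⟪scalarGrad g x, field u x⟫ := fun u => by
    rw [L2.inner_def]
    refine integral_congr_ae ?_
    filter_upwards [m1.coeFn_toLp] with x hx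
    rw [hx]
  have e2 : ∀ u : H01 Ω, ⟪m2.toLp, grad u⟫ = ∫ x in Ω, ⟪scalarId g x, grad u x⟫ := fun u => by
    rw [L2.inner_def]
    refine integral_congr_ae ?_
    filter_upwards [m2.coeFn_toLp] with x hx
    rw [hx]
  obtain ⟨s, hs, hlim⟩ := exists_seq_testPairs u
  -- Both sides are `L²` inner products with a fixed field, hence continuous in `u` for the `H^1`
  -- norm, so test fields suffice.
  have l1 := (tendsto_const_nhds (x := m1.toLp)).inner (𝕜 := ℝ)
    ((continuous_field.tendsto u).comp hlim)
  have l2 := ((tendsto_const_nhds (x := m2.toLp)).inner (𝕜 := ℝ)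
    ((continuous_grad.tendsto u).comp hlim)).neg
  rw [← e1, ← e2]
  refine tendsto_nhds_unique (l1.congr fun n => ?_) l2
  obtain ⟨ψ, h1, h2, h3, h4, h5⟩ := hs n
  simp only [Function.comp_apply]
  rw [e1, e2]
  have a1 : ∫ x in Ω, ⟪scalarGrad g x, field (s n) x⟫ = ∫ x, ⟪scalarGrad g x, ψ x⟫ := by
    rw [← setIntegral_eq_integral_of_forall_compl_eq_zero (s := Ω) (f := fun x => ⟪_, ψ x⟫)]
    · refine integral_congr_ae ?_
      filter_upwards [h4] with x hx
      rw [field, hx]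
    · intro x hx
      rw [image_eq_zero_of_notMem_tsupport fun h => hx (h3 h), inner_zero_right]
  have a2 : ∫ x in Ω, ⟪scalarId g x, grad (s n) x⟫
      = ∫ x, ⟪scalarId g x, classicalGrad ψ x⟫ := by
    rw [← setIntegral_eq_integral_of_forall_compl_eq_zero (s := Ω)
      (f := fun x => ⟪_, classicalGrad ψ x⟫)]
    · refine integral_congr_ae ?_
      filter_upwards [h5] with x hx
      rw [grad, hx]
    · intro x hx
      have h0 : fderiv ℝ ψ x = 0 := by
        by_contra h
        exact hx (h3 (support_fderiv_subset ℝ h))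
      have : classicalGrad ψ x = 0 := by
        ext i j
        simp [classicalGrad, h0]
      rw [this, inner_zero_right]
  rw [a1, a2]
  exact integral_inner_scalarGrad_of_test hg hc h1

/-- Pointwise `(u·∇ψ)·ψ = u·∇(|ψ|²/2)`, so integration by parts moves the derivative onto `u`, where
it becomes the divergence. Only `w` is smoothed: test fields approximating `u` need not be
divergence-free. -/
theorem trilinear_self_eq_zero_of_test {u w : H01 Ω} (hu : IsDivFree u)
    (hw : w.1 ∈ testPairs Ω) : trilinear u w w = 0 := by
  obtain ⟨ψ, h1, h2, h3, h4, h5⟩ := hw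
  set g : Vec q → ℝ := fun x => (1 / 2) * ⟪ψ x, ψ x⟫ with hg
  have gs : ContDiff ℝ ∞ g := contDiff_const.mul (h1.inner ℝ h1)
  have gc : HasCompactSupport g := by
    refine h2.mono fun x hx => ?_
    contrapose! hx
    have : ψ x = 0 := by simpa using hx
    simp [hg, this]
  have dg : ∀ x v, fderiv ℝ g x v = ⟪fderiv ℝ ψ x v, ψ x⟫ := fun x v => by
    have dψ : DifferentiableAt ℝ ψ x := (h1.differentiable (by simp)) x
    rw [hg, fderiv_const_mul (dψ.inner ℝ dψ)]
    simp only [_root_.smul_apply, smul_eq_mul]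
    rw [fderiv_inner_apply ℝ dψ dψ, real_inner_comm]
    ring
  have h := integral_inner_scalarGrad gs gc u
  have z : ∫ x in Ω, ⟪scalarId g x, grad u x⟫ = 0 := by
    rw [← integral_zero (Vec q) ℝ (μ := volume.restrict Ω)]
    refine integral_congr_ae ?_
    filter_upwards [hu] with x hx
    rw [inner_scalarId, hx, mul_zero]
  rw [z, neg_zero] at h
  rw [← h, trilinear, pair]
  refine integral_congr_ae ?_
  filter_upwards [h4, h5] with x hx hx'
  simp only [conv, inner_scalarGrad, dg, sum_inner, real_inner_smul_left]
  refine Finset.sum_congr rfl fun i _ => ?_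
  simp only [field, grad, hx, hx', classicalGrad]

/-- `b(u, w, w) = 0` for divergence-free `u`. -/
theorem trilinear_self_eq_zero (hq : q = 2 ∨ q = 3) (hΩb : Bornology.IsBounded Ω)
    {u : H01 Ω} (hu : IsDivFree u) (w : H01 Ω) : trilinear u w w = 0 := by
  obtain ⟨s, hs, hlim⟩ := exists_seq_testPairs w
  refine tendsto_nhds_unique (tendsto_trilinear_diag hq hΩb u w hlim) ?_
  simp only [trilinear_self_eq_zero_of_test hu (hs _)]
  exact tendsto_const_nhds

theorem IsDivFree.zero : IsDivFree (0 : H01 Ω) := by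
  have h : (grad (0 : H01 Ω)) =ᵐ[volume.restrict Ω] 0 := Lp.coeFn_zero _ _ _
  filter_upwards [h] with x hx
  simp [hx]

theorem IsDivFree.add {u v : H01 Ω} (hu : IsDivFree u) (hv : IsDivFree v) :
    IsDivFree (u + v) := by
  filter_upwards [hu, hv, Lp.coeFn_add (grad u) (grad v)] with x h1 h2 h3
  rw [grad_add, h3]
  simp [Finset.sum_add_distrib, h1, h2]

theorem IsDivFree.smul (c : ℝ) {u : H01 Ω} (hu : IsDivFree u) : IsDivFree (c • u) := by
  filter_upwards [hu, Lp.coeFn_smul c (grad u)] with x h1 h2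
  rw [show grad (c • u) = c • grad u from rfl, h2]
  simp [← Finset.mul_sum, h1]

theorem isDivFree_of_mem_romSpace {d : ℕ} {φ : Fin d → H01 Ω} (hφ : ∀ i, IsDivFree (φ i)) {r : ℕ}
    {u : H01 Ω} (hu : u ∈ romSpace φ r) : IsDivFree u := by
  induction hu using Submodule.span_induction with
  | mem x hx =>
    obtain ⟨i, -, rfl⟩ := hx
    exact hφ i
  | zero => exact .zero
  | add x y _ _ hx hy => exact hx.add hy
  | smul c x _ hx => exact hx.smul c

variable {d : ℕ}

/-! ### Young's inequality and discrete Gronwall. -/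

/-- Young's inequality with exponents `4` and `4/3`, in the form needed for the convective term. -/
theorem two_mul_sqrt_mul_le_young {Re a b : ℝ} (C p : ℝ) (hRe : 0 < Re) (ha : 0 ≤ a)
    (hb : 0 ≤ b) :
    2 * (C * √(a * b) * p * b) ≤ Re⁻¹ * b ^ 2 + 27 * Re ^ 3 * C ^ 4 / 16 * p ^ 4 * a ^ 2 := by
  -- Writing `a = s²`, `b = t²` turns the claim into a polynomial inequality.
  obtain ⟨s, rfl⟩ : ∃ s, a = s ^ 2 := ⟨√a, (Real.sq_sqrt ha).symm⟩
  obtain ⟨t, ht, rfl⟩ : ∃ t, 0 ≤ t ∧ b = t ^ 2 := ⟨√b, b.sqrt_nonneg, (Real.sq_sqrt hb).symm⟩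
  have hs : √(s ^ 2 * t ^ 2) = |s| * t := by
    rw [← mul_pow, Real.sqrt_sq_eq_abs, abs_mul, abs_of_nonneg ht]
  rw [hs, ← sq_abs s]
  generalize |s| = σ
  -- `m` is the double root of the quartic in `t`: `3t⁴ - 4mt³ + m⁴ = (t - m)²(2t² + (t + m)²)`.
  -- This is the source of `27/16`.
  set m := 3 / 2 * (Re * C * p * σ) with hm
  have key : 0 ≤ (t - m) ^ 2 * (2 * t ^ 2 + (t + m) ^ 2) := by positivity
  have e : Re⁻¹ * (t ^ 2) ^ 2 + 27 * Re ^ 3 * C ^ 4 / 16 * p ^ 4 * (σ ^ 2) ^ 2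
      - 2 * (C * (σ * t) * p * t ^ 2)
      = Re⁻¹ / 3 * ((t - m) ^ 2 * (2 * t ^ 2 + (t + m) ^ 2)) := by
    rw [hm]
    field_simp
    ring
  have := mul_nonneg (show 0 ≤ Re⁻¹ / 3 by positivity) key
  linarith

/-- A discrete Gronwall inequality for implicit schemes. -/
theorem discrete_gronwall_implicit {M : ℕ} {a b c x : ℕ → ℝ} (ha0 : a 0 = 0)
    (hb : ∀ n, 0 ≤ b n) (hc : ∀ n, 0 ≤ c n)
    (hx0 : ∀ n, 0 ≤ x n) (hx1 : ∀ n ∈ Finset.Icc 1 M, x n < 1)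
    (h : ∀ n < M, a (n + 1) + b (n + 1) ≤ a n + x (n + 1) * a (n + 1) + c (n + 1)) :
    ∀ n ≤ M, a n + ∑ j ∈ Finset.Icc 1 n, b j ≤
      Real.exp (∑ j ∈ Finset.Icc 1 n, x j / (1 - x j)) * ∑ j ∈ Finset.Icc 1 n, c j := by
  intro n
  induction n with
  | zero => simp [ha0]
  | succ n ih =>
    intro hn
    have hx : x (n + 1) < 1 := hx1 _ (by simp; omega)
    have hpos : 0 < 1 - x (n + 1) := by linarith
    rw [Finset.sum_Icc_succ_top (by omega), Finset.sum_Icc_succ_top (by omega),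
      Finset.sum_Icc_succ_top (by omega), Real.exp_add]
    have ih := ih (by omega)
    have step := h n (by omega)
    set B := ∑ j ∈ Finset.Icc 1 n, b j
    set S := ∑ j ∈ Finset.Icc 1 n, x j / (1 - x j)
    set T := ∑ j ∈ Finset.Icc 1 n, c j
    have hB : 0 ≤ B := Finset.sum_nonneg fun _ _ => hb _
    have hS : 0 ≤ S := Finset.sum_nonneg fun j hj => by
      have : x j < 1 := hx1 j (by simp at hj ⊢; omega)
      exact div_nonneg (hx0 j) (by linarith)
    have hexpS : 1 ≤ Real.exp S := Real.one_le_exp hS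
    -- `1/(1 - x) = 1 + x/(1 - x)`, and `1 + y ≤ exp y`.
    have hle : (1 - x (n + 1))⁻¹ ≤ Real.exp (x (n + 1) / (1 - x (n + 1))) := by
      refine le_trans (le_of_eq ?_) (Real.add_one_le_exp _)
      field_simp
      ring
    -- Add `B` to the one-step inequality and apply the induction hypothesis; the nonnegative `x (B
    -- + b)` is discarded and `exp S ≥ 1` takes in the new `c`.
    have h1 : (1 - x (n + 1)) * (a (n + 1) + (B + b (n + 1))) ≤ Real.exp S * (T + c (n + 1)) := by
      have e1 := mul_nonneg (hx0 (n + 1)) (add_nonneg hB (hb (n + 1)))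
      have e2 := mul_le_mul_of_nonneg_right hexpS (hc (n + 1))
      linarith
    have hT : 0 ≤ T + c (n + 1) := add_nonneg (Finset.sum_nonneg fun _ _ => hc _) (hc _)
    calc a (n + 1) + (B + b (n + 1))
        = (1 - x (n + 1))⁻¹ * ((1 - x (n + 1)) * (a (n + 1) + (B + b (n + 1)))) := by
          rw [inv_mul_cancel_left₀ hpos.ne']
      _ ≤ (1 - x (n + 1))⁻¹ * (Real.exp S * (T + c (n + 1))) := by gcongr
      _ ≤ Real.exp (x (n + 1) / (1 - x (n + 1))) * (Real.exp S * (T + c (n + 1))) := by gcongr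
      _ = _ := by ring

/-! ### Reduced spaces and projections. -/

theorem romSpace_mono (φ : Fin d → H01 Ω) {r s : ℕ} (h : r ≤ s) : romSpace φ r ≤ romSpace φ s :=
  Submodule.span_mono (image_mono fun _ hi => lt_of_lt_of_le hi h)

theorem mem_romSpace (φ : Fin d → H01 Ω) {r : ℕ} {i : Fin d} (hi : i.val < r) :
    φ i ∈ romSpace φ r :=
  Submodule.subset_span (mem_image_of_mem _ hi)

theorem projP_mem (φ : Fin d → H01 Ω) (r : ℕ) (g : Vec q → Vec q) :
    projP φ r g ∈ romSpace φ r :=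
  Submodule.sum_mem _ fun _ hi =>
    Submodule.smul_mem _ _ (mem_romSpace φ (Finset.mem_filter.1 hi).2)

/-- Passes from the span indexed inside `Fin d` to coordinates in `Fin r`, where the matrix `Ã`
acts. -/
theorem exists_eq_sum_of_mem_romSpace {φ : Fin d → H01 Ω} {r : ℕ} (hr : r ≤ d) {v : H01 Ω}
    (hv : v ∈ romSpace φ r) : ∃ a : Fin r → ℝ, v = ∑ k, a k • φ (Fin.castLE hr k) := by
  have : φ '' {i | i.val < r} = range fun k : Fin r => φ (Fin.castLE hr k) := by
    ext y
    constructor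
    · rintro ⟨i, hi, rfl⟩
      exact ⟨⟨i, hi⟩, rfl⟩
    · rintro ⟨k, rfl⟩
      exact ⟨_, k.2, rfl⟩
  rw [romSpace, this, Submodule.mem_span_range_iff_exists_fun] at hv
  obtain ⟨a, ha⟩ := hv
  exact ⟨a, ha.symm⟩

theorem pair_field (u w : H01 Ω) : pair (field u) w = ⟪field u, field w⟫ := rfl

theorem integrableOn_inner_field (u w : H01 Ω) :
    IntegrableOn (fun x => ⟪field u x, field w x⟫) Ω :=
  L2.integrable_inner (field u) (field w)

theorem coeFn_sum_ae {ι : Type*} (s : Finset ι) (v : ι → L2Vec Ω) :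
    (∑ i ∈ s, v i : L2Vec Ω) =ᵐ[volume.restrict Ω] fun x => ∑ i ∈ s, v i x := by
  classical
  induction s using Finset.induction_on with
  | empty => exact Lp.coeFn_zero (Vec q) 2 (volume.restrict Ω)
  | insert i s hi ih =>
    rw [Finset.sum_insert hi]
    filter_upwards [Lp.coeFn_add (v i) (∑ i ∈ s, v i), ih] with x h1 h2
    rw [h1, Pi.add_apply, h2, Finset.sum_insert hi]

/-- The pairing against a linear combination, together with its existence. -/
theorem pair_sum {ι : Type*} (s : Finset ι) {g : Vec q → Vec q} {v : ι → H01 Ω} (a : ι → ℝ)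
    (h : ∀ i ∈ s, IntegrableOn (fun x => ⟪g x, field (v i) x⟫) Ω) :
    IntegrableOn (fun x => ⟪g x, field (∑ i ∈ s, a i • v i) x⟫) Ω ∧
      pair g (∑ i ∈ s, a i • v i) = ∑ i ∈ s, a i * pair g (v i) := by
  have key : (fun x => ⟪g x, field (∑ i ∈ s, a i • v i) x⟫) =ᵐ[volume.restrict Ω]
      fun x => ∑ i ∈ s, a i * ⟪g x, field (v i) x⟫ := by
    have h1 : field (∑ i ∈ s, a i • v i) =ᵐ[volume.restrict Ω]
        fun x => ∑ i ∈ s, a i • field (v i) x := by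
      rw [field_sum]
      refine (coeFn_sum_ae s fun i => field (a i • v i)).trans ?_
      have : ∀ᵐ x ∂volume.restrict Ω, ∀ i ∈ s, field (a i • v i) x = a i • field (v i) x :=
        (ae_ball_iff s.countable_toSet).2 fun i _ => Lp.coeFn_smul (a i) (field (v i))
      filter_upwards [this] with x hx
      exact Finset.sum_congr rfl hx
    filter_upwards [h1] with x hx
    rw [hx, inner_sum]
    simp only [inner_smul_right]
  have hi : ∀ i ∈ s, Integrable (fun x => a i * ⟪g x, field (v i) x⟫) (volume.restrict Ω) :=
    fun i hi => (h i hi).const_mul _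
  refine ⟨(integrable_finsetSum s hi).congr key.symm, ?_⟩
  rw [pair, integral_congr_ae key, integral_finsetSum s hi]
  simp only [integral_const_mul, pair]

/-- `(P_r g, v) = (g, v)` for `v ∈ X^r`. -/
theorem inner_projP {φ : Fin d → H01 Ω} (ho : Orthonormal ℝ fun i => field (φ i)) {r : ℕ}
    (hr : r ≤ d) {g : Vec q → Vec q}
    (hg : ∀ i : Fin r, IntegrableOn (fun x => ⟪g x, field (φ (Fin.castLE hr i)) x⟫) Ω)
    {v : H01 Ω} (hv : v ∈ romSpace φ r) :
    ⟪field (projP φ r g), field v⟫ = pair g v := by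
  obtain ⟨a, rfl⟩ := exists_eq_sum_of_mem_romSpace hr hv
  rw [(pair_sum Finset.univ a fun i _ => hg i).2, field_sum, inner_sum]
  refine Finset.sum_congr rfl fun k _ => ?_
  rw [field_smul, inner_smul_right, projP, field_sum]
  simp only [field_smul]
  rw [ho.inner_left_sum (fun i => pair g (φ i)) (Finset.mem_filter.2 ⟨Finset.mem_univ _, k.2⟩)]
  simp

theorem inner_projP_field {φ : Fin d → H01 Ω} (ho : Orthonormal ℝ fun i => field (φ i)) {r : ℕ}
    (hr : r ≤ d) (u : H01 Ω) {v : H01 Ω} (hv : v ∈ romSpace φ r) :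
    ⟪field (projP φ r (field u)), field v⟫ = ⟪field u, field v⟫ :=
  inner_projP ho hr (fun _ => integrableOn_inner_field _ _) hv

theorem projP_add_projQ {φ : Fin d → H01 Ω} (ho : Orthonormal ℝ fun i => field (φ i)) (r : ℕ)
    {u : H01 Ω} (hu : u ∈ romSpace φ d) :
    projP φ r (field u) + projQ φ r (field u) = u := by
  have h : projP φ r (field u) + projQ φ r (field u) = ∑ i, pair (field u) (φ i) • φ i := by
    rw [projP, projQ, ← Finset.sum_filter_add_sum_filter_not Finset.univ (fun i : Fin d => i.val < r)]
    simp only [not_lt]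
  rw [h]
  obtain ⟨a, ha⟩ := exists_eq_sum_of_mem_romSpace le_rfl hu
  conv_rhs => rw [ha]
  refine Finset.sum_congr rfl fun k _ => ?_
  have : pair (field u) (φ k) = a k := by
    rw [pair_field, ha, field_sum]
    simp only [field_smul]
    exact ho.inner_left_fintype a k
  rw [this]
  rfl

theorem sum_smul_sub_sum_smul {ι : Type*} [Fintype ι] (v : ι → H01 Ω) (a b : ι → ℝ) :
    ∑ k, a k • v k - ∑ k, b k • v k = ∑ k, (a - b) k • v k := by
  rw [← Finset.sum_sub_distrib]
  exact Finset.sum_congr rfl fun k _ => (sub_smul (a k) (b k) (v k)).symm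

/-! ### Closure terms. -/

/-- The closure operators given by a negative semidefinite matrix are monotone on `X^r`. -/
theorem closure_monotone {φ : Fin d → H01 Ω} {r : ℕ} {hr : r ≤ d} {τ : H01 Ω → Vec q → Vec q}
    (hτ : τ ∈ linearClosures φ r hr) {z w : H01 Ω} (hz : z ∈ romSpace φ r)
    (hw : w ∈ romSpace φ r) : pair (τ w) (z - w) ≤ pair (τ z) (z - w) := by
  obtain ⟨A, hA, h⟩ := hτ
  obtain ⟨a, ha⟩ := exists_eq_sum_of_mem_romSpace hr hz
  obtain ⟨b, hb⟩ := exists_eq_sum_of_mem_romSpace hr hw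
  have e : z - w = ∑ k, (a - b) k • φ (Fin.castLE hr k) := by
    rw [ha, hb, sum_smul_sub_sum_smul]
  have p : ∀ c : Fin r → ℝ, pair (τ (∑ k, c k • φ (Fin.castLE hr k))) (z - w)
      = -((a - b) ⬝ᵥ A.mulVec c) := fun c => by
    rw [e, (pair_sum Finset.univ (a - b) fun i _ => (h c i).1).2, dotProduct,
      ← Finset.sum_neg_distrib]
    refine Finset.sum_congr rfl fun i _ => ?_
    rw [← (h c i).2]
    ring
  have hAab := hA (a - b)
  -- The pairings are linear in the coordinates, so their difference is `-(a - b)ᵀ Ã (a - b) ≥ 0`.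
  rw [Matrix.mulVec_sub, dotProduct_sub] at hAab
  have pa := p a
  have pb := p b
  rw [← ha] at pa
  rw [← hb] at pb
  rw [pa, pb]
  linarith

/-- Against `v ∈ X^r` the projection drops out. No term is assumed to be in `L²`, so splitting the
integral rests on the existence of each pairing. -/
theorem inner_closureError (hq : q = 2 ∨ q = 3) (hΩb : Bornology.IsBounded Ω)
    {φ : Fin d → H01 Ω} (ho : Orthonormal ℝ fun i => field (φ i)) {r : ℕ} {hr : r ≤ d}
    {τ : H01 Ω → Vec q → Vec q} (hτ : τ ∈ linearClosures φ r hr) (u : H01 Ω) {v : H01 Ω}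
    (hv : v ∈ romSpace φ r) :
    ⟪field (closureError φ r τ u), field v⟫ =
      trilinear u u v - trilinear (projP φ r (field u)) (projP φ r (field u)) v
        - pair (τ (projP φ r (field u))) v := by
  have iτ : ∀ i : Fin r, IntegrableOn (fun x =>
      ⟪τ (projP φ r (field u)) x, field (φ (Fin.castLE hr i)) x⟫) Ω := fun i => by
    obtain ⟨A, -, h⟩ := hτ
    obtain ⟨a, ha⟩ := exists_eq_sum_of_mem_romSpace hr (projP_mem φ r (field u))
    rw [ha]
    exact (h a i).1
  have iu := integrableOn_conv hq hΩb u u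
  have iP := integrableOn_conv hq hΩb (projP φ r (field u)) (projP φ r (field u))
  rw [closureError, inner_projP ho hr _ hv]
  · have iτv : IntegrableOn (fun x => ⟪τ (projP φ r (field u)) x, field v x⟫) Ω := by
      obtain ⟨a, ha⟩ := exists_eq_sum_of_mem_romSpace hr hv
      rw [ha]
      exact (pair_sum Finset.univ a fun i _ => iτ i).1
    simp only [trilinear, pair, tauFOM, inner_sub_left]
    rw [← integral_sub (iu v) (iP v)]
    exact integral_sub ((iu v).sub (iP v)) iτv
  · intro i
    simp only [tauFOM, inner_sub_left]
    exact ((iu _).sub (iP _)).sub (iτ i)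

/-! ### Error estimate and verifiability. -/

theorem gronwallCoeff_nonneg (φ : Fin d → H01 Ω) (r : ℕ) {Re : ℝ} (hRe : 0 < Re) (C : ℝ)
    (u : H01 Ω) : 0 ≤ gronwallCoeff φ r Re C u := by
  have : 0 ≤ C ^ 4 := by positivity
  rw [gronwallCoeff]
  positivity

/-- The error equation tested with the error, for one step of the scheme. -/
theorem error_energy (hq : q = 2 ∨ q = 3) (hΩb : Bornology.IsBounded Ω) {Re dt : ℝ} {M : ℕ}
    {φ : Fin d → H01 Ω} (ho : Orthonormal ℝ fun i => field (φ i)) (hdiv : ∀ i, IsDivFree (φ i))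
    {f : ℕ → L2Vec Ω} {ud : ℕ → H01 Ω} (hud : IsTruthSolution φ Re dt f M ud) {r : ℕ}
    {hr : r ≤ d} (hcomm : NoCommutationError φ r Re M ud) {τ : H01 Ω → Vec q → Vec q}
    (hτ : τ ∈ linearClosures φ r hr) {ur : ℕ → H01 Ω}
    (hur : IsROMSolution φ r Re dt f M ud τ ur) {n : ℕ} (hn : n < M) {P e e₀ : H01 Ω}
    (hP : P = projP φ r (field (ud (n + 1)))) (he : e = P - ur (n + 1))
    (he₀ : e₀ = projP φ r (field (ud n)) - ur n) :
    dt⁻¹ * (‖field e‖ ^ 2 - ⟪field e₀, field e⟫) + Re⁻¹ * ‖grad e‖ ^ 2 ≤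
      -trilinear e P e - ⟪field (closureError φ r τ (ud (n + 1))), field e⟫ := by
  obtain ⟨hudmem, hudeq⟩ := hud
  obtain ⟨-, hurmem, hureq⟩ := hur
  have hPmem : P ∈ romSpace φ r := hP ▸ projP_mem φ r _
  have hrmem : ur (n + 1) ∈ romSpace φ r := hurmem _ hn
  have hemem : e ∈ romSpace φ r := he ▸ sub_mem hPmem hrmem
  have h1 := hudeq n hn e (romSpace_mono φ hr hemem)
  have h2 := hureq n hn e hemem
  have h0 : pair (fun _ => (0 : Vec q)) e = 0 := by simp [pair]
  have hgrad : Re⁻¹ * ⟪grad (ud (n + 1)), grad e⟫ = Re⁻¹ * ⟪grad P, grad e⟫ := by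
    have hQ := hcomm (n + 1) (Finset.mem_Icc.2 ⟨Nat.le_add_left 1 n, hn⟩) e hemem
    have hs := congrArg grad (projP_add_projQ ho r (hudmem (n + 1) hn))
    rw [grad_add, ← hP] at hs
    rw [← hs, inner_add_left, mul_add, hQ, add_zero]
  have hE := inner_closureError hq hΩb ho hτ (ud (n + 1)) hemem
  rw [← hP] at hE
  have hmono : pair (τ (ur (n + 1))) e ≤ pair (τ P) e := he ▸ closure_monotone hτ hPmem hrmem
  have hskew : trilinear (ur (n + 1)) e e = 0 :=
    trilinear_self_eq_zero hq hΩb (isDivFree_of_mem_romSpace hdiv hrmem) e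
  -- Inserting `b(u_r, P, e)` leaves `b(e, P, e) + b(u_r, e, e)`, and the second term is zero by
  -- `hskew`.
  have hb : trilinear P P e - trilinear (ur (n + 1)) (ur (n + 1)) e = trilinear e P e := by
    have a1 := trilinear_sub_left hq hΩb P (ur (n + 1)) P e
    have a2 := trilinear_sub_mid hq hΩb (ur (n + 1)) P (ur (n + 1)) e
    rw [← he] at a1 a2
    linarith
  have hge : ‖grad e‖ ^ 2 = ⟪grad P, grad e⟫ - ⟪grad (ur (n + 1)), grad e⟫ := by
    rw [← inner_sub_left, ← grad_sub, ← he, real_inner_self_eq_norm_sq]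
  have hfe : ‖field e‖ ^ 2 = ⟪field (ud (n + 1)), field e⟫ - ⟪field (ur (n + 1)), field e⟫ := by
    rw [← inner_projP_field ho hr (ud (n + 1)) hemem, ← hP, ← inner_sub_left, ← field_sub, ← he,
      real_inner_self_eq_norm_sq]
  have hfe₀ : ⟪field e₀, field e⟫ = ⟪field (ud n), field e⟫ - ⟪field (ur n), field e⟫ := by
    rw [← inner_projP_field ho hr (ud n) hemem, ← inner_sub_left, ← field_sub, ← he₀]
  rw [h0, hgrad, real_inner_smul_left, inner_sub_left] at h1
  rw [real_inner_smul_left, inner_sub_left] at h2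
  rw [hfe, hfe₀, hge, ← hb, hE]
  linarith

/-- The Young inequalities that turn the tested error equation into an energy inequality. Here `x`,
`g`, `p`, `y`, `z` are the norms of `e`, `∇e`, `∇P`, the previous error and the closure error, and
`s` is the inner product of `e` with the previous error. -/
theorem energy_ineq_of_tested {C Re dt x g y z p s b c : ℝ} (hRe : 0 < Re) (hdt : 0 < dt)
    (hx : 0 ≤ x) (hg : 0 ≤ g)
    (energy : dt⁻¹ * (x ^ 2 - s) + Re⁻¹ * g ^ 2 ≤ -b - c) (hb : -b ≤ C * √(x * g) * p * g)
    (hc : -c ≤ z * x) (hs : s ≤ y * x) :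
    x ^ 2 + dt * (Re⁻¹ * g ^ 2) ≤
      y ^ 2 + dt * (27 * Re ^ 3 * C ^ 4 / 16 * p ^ 4 + Re) * x ^ 2 + dt * (Re⁻¹ * z ^ 2) := by
  -- The tested inequality is doubled; Young uses up one of the two copies of `Re⁻¹ g²`, and the
  -- other stays on the left.
  have hyoung := two_mul_sqrt_mul_le_young C p hRe hx hg
  -- This weighting yields the summand `Re` of `d_j`.
  have hz : 2 * (z * x) ≤ Re⁻¹ * z ^ 2 + Re * x ^ 2 := by
    have h : Re⁻¹ * z ^ 2 + Re * x ^ 2 - 2 * (z * x) = Re⁻¹ * (z - Re * x) ^ 2 := by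
      field_simp
      ring
    have : 0 ≤ Re⁻¹ * (z - Re * x) ^ 2 := by positivity
    linarith
  have hs2 : 2 * s ≤ y ^ 2 + x ^ 2 := by linarith [two_mul_le_add_sq y x]
  have energy2 := mul_le_mul_of_nonneg_left energy hdt.le
  rw [mul_add, mul_inv_cancel_left₀ hdt.ne'] at energy2
  have hmul := mul_le_mul_of_nonneg_left (add_le_add hyoung hz) hdt.le
  have hmul2 := mul_le_mul_of_nonneg_left (add_le_add hb hc) hdt.le
  linarith

/-- The energy inequality for one step of the error equation. -/
theorem error_step (hq : q = 2 ∨ q = 3) (hΩb : Bornology.IsBounded Ω) {C : ℝ}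
    (hC : IsTrilinearConst Ω C) {Re dt : ℝ} (hRe : 0 < Re) (hdt : 0 < dt) {M : ℕ}
    {φ : Fin d → H01 Ω} (ho : Orthonormal ℝ fun i => field (φ i)) (hdiv : ∀ i, IsDivFree (φ i))
    {f : ℕ → L2Vec Ω} {ud : ℕ → H01 Ω} (hud : IsTruthSolution φ Re dt f M ud) {r : ℕ}
    {hr : r ≤ d} (hcomm : NoCommutationError φ r Re M ud) {τ : H01 Ω → Vec q → Vec q}
    (hτ : τ ∈ linearClosures φ r hr) {ur : ℕ → H01 Ω}
    (hur : IsROMSolution φ r Re dt f M ud τ ur) {n : ℕ} (hn : n < M) :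
    ‖field (projP φ r (field (ud (n + 1))) - ur (n + 1))‖ ^ 2
        + dt * (Re⁻¹ * ‖grad (projP φ r (field (ud (n + 1))) - ur (n + 1))‖ ^ 2) ≤
      ‖field (projP φ r (field (ud n)) - ur n)‖ ^ 2
        + dt * gronwallCoeff φ r Re C (ud (n + 1))
          * ‖field (projP φ r (field (ud (n + 1))) - ur (n + 1))‖ ^ 2
        + dt * (Re⁻¹ * ‖field (closureError φ r τ (ud (n + 1)))‖ ^ 2) := by
  refine energy_ineq_of_tested hRe hdt (norm_nonneg _) (norm_nonneg _)
    (error_energy hq hΩb ho hdiv hud hcomm hτ hur hn rfl rfl rfl) ?_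
    ((neg_le_abs _).trans (abs_real_inner_le_norm _ _)) (real_inner_le_norm _ _)
  generalize projP φ r (field (ud (n + 1))) - ur (n + 1) = e
  -- The admissible bound is one-sided, so `-b(e, P, e)` is bounded through the first argument `-e`.
  have := hC.2 (-e) (projP φ r (field (ud (n + 1)))) e
  rwa [trilinear_neg_left, field_neg, grad_neg, norm_neg, norm_neg] at this

theorem error_bound (hq : q = 2 ∨ q = 3) (hΩb : Bornology.IsBounded Ω) {C : ℝ}
    (hC : IsTrilinearConst Ω C) {Re dt : ℝ} (hRe : 0 < Re) (hdt : 0 < dt) {M : ℕ}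
    {φ : Fin d → H01 Ω} (ho : Orthonormal ℝ fun i => field (φ i)) (hdiv : ∀ i, IsDivFree (φ i))
    {f : ℕ → L2Vec Ω} {ud : ℕ → H01 Ω} (hud : IsTruthSolution φ Re dt f M ud) {r : ℕ}
    {hr : r ≤ d} (hcomm : NoCommutationError φ r Re M ud)
    (hsmall : ∀ j ∈ Finset.Icc 1 M, dt * gronwallCoeff φ r Re C (ud j) < 1)
    {τ : H01 Ω → Vec q → Vec q} (hτ : τ ∈ linearClosures φ r hr) {ur : ℕ → H01 Ω}
    (hur : IsROMSolution φ r Re dt f M ud τ ur) {n : ℕ} (hn : n ≤ M) :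
    ‖field (projP φ r (field (ud n)) - ur n)‖ ^ 2
        + dt * ∑ j ∈ Finset.Icc 1 n, Re⁻¹ * ‖grad (projP φ r (field (ud j)) - ur j)‖ ^ 2 ≤
      Real.exp (dt * ∑ j ∈ Finset.Icc 1 n,
          gronwallCoeff φ r Re C (ud j) / (1 - dt * gronwallCoeff φ r Re C (ud j)))
        * (dt * ∑ j ∈ Finset.Icc 1 n, Re⁻¹ * ‖field (closureError φ r τ (ud j))‖ ^ 2) := by
  have h := discrete_gronwall_implicit (M := M)
    (a := fun n => ‖field (projP φ r (field (ud n)) - ur n)‖ ^ 2)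
    (b := fun n => dt * (Re⁻¹ * ‖grad (projP φ r (field (ud n)) - ur n)‖ ^ 2))
    (c := fun n => dt * (Re⁻¹ * ‖field (closureError φ r τ (ud n))‖ ^ 2))
    (x := fun n => dt * gronwallCoeff φ r Re C (ud n))
    (by simp [hur.1, show field (0 : H01 Ω) = 0 from rfl]) (fun _ => by positivity) (fun _ => by positivity)
    (fun n => mul_nonneg hdt.le (gronwallCoeff_nonneg φ r hRe C (ud n))) hsmall
    (fun n hn => error_step hq hΩb hC hRe hdt ho hdiv hud hcomm hτ hur hn) n hn
  simpa only [Finset.mul_sum, mul_div_assoc] using h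

/-- The coefficients `d_j` depend on `r` but not on the closure or the ROM solution, and only `r =
0, …, d` occur; summing the nonnegative constants `F r` gives one valid for all. -/
theorem isVerifiable_linearClosures (hq : q = 2 ∨ q = 3) (hΩb : Bornology.IsBounded Ω) {C : ℝ}
    (hC : IsTrilinearConst Ω C) {Re dt : ℝ} (hRe : 0 < Re) (hdt : 0 < dt) {M : ℕ}
    {φ : Fin d → H01 Ω} (ho : Orthonormal ℝ fun i => field (φ i)) (hdiv : ∀ i, IsDivFree (φ i))
    {f : ℕ → L2Vec Ω} {ud : ℕ → H01 Ω} (hud : IsTruthSolution φ Re dt f M ud)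
    (h : ∀ r ≤ d, NoCommutationError φ r Re M ud ∧
      ∀ j ∈ Finset.Icc 1 M, dt * gronwallCoeff φ r Re C (ud j) < 1) :
    IsVerifiable φ Re dt f M ud (linearClosures φ) := by
  set c : ℕ → ℕ → ℝ := fun r j =>
    gronwallCoeff φ r Re C (ud j) / (1 - dt * gronwallCoeff φ r Re C (ud j)) with hc
  set F : ℕ → ℝ := fun r => Real.exp (dt * ∑ j ∈ Finset.Icc 1 M, c r j) * (dt * Re⁻¹ * M) with hF
  have hF0 : ∀ r ∈ Finset.range (d + 1), 0 ≤ F r := fun r _ => by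
    rw [hF]
    positivity
  refine ⟨∑ r ∈ Finset.range (d + 1), F r, fun r hr τ hτ ur hur n hn => ?_⟩
  obtain ⟨hn1, hnM⟩ := Finset.mem_Icc.1 hn
  have hc0 : ∀ j ∈ Finset.Icc 1 M, 0 ≤ c r j := fun j hj =>
    div_nonneg (gronwallCoeff_nonneg φ r hRe C (ud j)) (by linarith [(h r hr).2 j hj])
  have hb := error_bound hq hΩb hC hRe hdt ho hdiv hud (h r hr).1 (h r hr).2 hτ hur hnM
  have hgrad : 0 ≤ dt * ∑ j ∈ Finset.Icc 1 n,
      Re⁻¹ * ‖grad (projP φ r (field (ud j)) - ur j)‖ ^ 2 := by positivity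
  set S := ∑ j ∈ Finset.Icc 1 n, ‖field (closureError φ r τ (ud j))‖ ^ 2 with hS
  have hS0 : 0 ≤ S := by positivity
  rw [← Finset.mul_sum _ (fun j => ‖field (closureError φ r τ (ud j))‖ ^ 2), ← hS] at hb
  have hn0 : (0 : ℝ) < n := by exact_mod_cast hn1
  -- `M/n ≥ 1` trades the sum for an average, at the cost of the factor `M` in `F`.
  have hMn : 1 ≤ M * (n : ℝ)⁻¹ := by
    rw [← div_eq_mul_inv, one_le_div hn0]
    exact_mod_cast hnM
  calc ‖field (projP φ r (field (ud n)) - ur n)‖ ^ 2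
      ≤ Real.exp (dt * ∑ j ∈ Finset.Icc 1 n, c r j) * (dt * (Re⁻¹ * S)) := by linarith
    _ ≤ Real.exp (dt * ∑ j ∈ Finset.Icc 1 M, c r j) * (dt * (Re⁻¹ * S)) := by
        gcongr ?_ * _
        refine Real.exp_le_exp.2 (mul_le_mul_of_nonneg_left ?_ hdt.le)
        exact Finset.sum_le_sum_of_subset_of_nonneg (Finset.Icc_subset_Icc_right hnM)
          fun j hj _ => hc0 j hj
    _ ≤ Real.exp (dt * ∑ j ∈ Finset.Icc 1 M, c r j) * (dt * (Re⁻¹ * S)) * (M * (n : ℝ)⁻¹) :=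
        le_mul_of_one_le_right (by positivity) hMn
    _ = F r * ((n : ℝ)⁻¹ * S) := by
        rw [hF]
        ring
    _ ≤ _ := by
        refine mul_le_mul_of_nonneg_right ?_ (by positivity)
        exact Finset.single_le_sum hF0 (Finset.mem_range.2 (Nat.lt_succ_of_le hr))

end DDVMS

end

theorem mainTheorem2 {q : ℕ} (hq : q = 2 ∨ q = 3) (Ω : Set (DDVMS.Vec q)) (hΩ : IsOpen Ω)
    (hΩb : Bornology.IsBounded Ω) :
    (∀ u v w : DDVMS.H01 Ω,
      IntegrableOn (fun x => ⟪DDVMS.conv u v x, DDVMS.field w x⟫) Ω) ∧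
    (∃ C : ℝ, DDVMS.IsTrilinearConst Ω C) ∧
    ∀ C : ℝ, DDVMS.IsTrilinearConst Ω C →
    ∀ (Re dt : ℝ), 0 < Re → 0 < dt → ∀ (M d : ℕ) (φ : Fin d → DDVMS.H01 Ω),
    Orthonormal ℝ (fun i => DDVMS.field (φ i)) → (∀ i, DDVMS.IsDivFree (φ i)) →
    ∀ (f : ℕ → DDVMS.L2Vec Ω) (ud : ℕ → DDVMS.H01 Ω),
    DDVMS.IsTruthSolution φ Re dt f M ud →
    (∀ (r : ℕ) (hr : r ≤ d), DDVMS.NoCommutationError φ r Re M ud →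
      (∀ j ∈ Finset.Icc 1 M, dt * DDVMS.gronwallCoeff φ r Re C (ud j) < 1) →
      ∀ τ ∈ DDVMS.linearClosures φ r hr, ∀ ur : ℕ → DDVMS.H01 Ω,
      DDVMS.IsROMSolution φ r Re dt f M ud τ ur → ∀ n ∈ Finset.Icc 1 M,
        ‖DDVMS.field (DDVMS.projP φ r (DDVMS.field (ud n)) - ur n)‖ ^ 2
          + dt * ∑ j ∈ Finset.Icc 1 n,
              Re⁻¹ * ‖DDVMS.grad (DDVMS.projP φ r (DDVMS.field (ud j)) - ur j)‖ ^ 2 ≤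
        Real.exp (dt * ∑ j ∈ Finset.Icc 1 n,
            DDVMS.gronwallCoeff φ r Re C (ud j) / (1 - dt * DDVMS.gronwallCoeff φ r Re C (ud j)))
          * (dt * ∑ j ∈ Finset.Icc 1 n,
              Re⁻¹ * ‖DDVMS.field (DDVMS.closureError φ r τ (ud j))‖ ^ 2)) ∧
    ((∀ r ≤ d, DDVMS.NoCommutationError φ r Re M ud ∧
        ∀ j ∈ Finset.Icc 1 M, dt * DDVMS.gronwallCoeff φ r Re C (ud j) < 1) →
      DDVMS.IsVerifiable φ Re dt f M ud (DDVMS.linearClosures φ)) := by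
  refine ⟨DDVMS.integrableOn_conv hq hΩb, DDVMS.exists_isTrilinearConst hq hΩb, ?_⟩
  intro C hC Re dt hRe hdt M d φ ho hdiv f ud hud
  refine ⟨fun r hr hcomm hsmall τ hτ ur hur n hn => ?_, fun h => ?_⟩
  · exact DDVMS.error_bound hq hΩb hC hRe hdt ho hdiv hud hcomm hsmall hτ hur
      (Finset.mem_Icc.1 hn).2
  · exact DDVMS.isVerifiable_linearClosures hq hΩb hC hRe hdt ho hdiv hud h
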